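/- Let $q$ be a complex number with $0<|q|<1$, fix a logarithm $\log q$ of $q$ and put $q^a=e^{a\log q}$ for $a\in\mathbb C$. Write $(a;q)_n=\prod_{j=0}^{n-1}(1-aq^j)$, $(a;q)_\infty=\prod_{j\ge 0}(1-aq^j)$, $(a_1,\dots,a_N;q)_\infty=\prod_k(a_k;q)_\infty$ and $${}_4\phi_3\!\left({a_1,a_2,a_3,a_4\atop b_1,b_2,b_3};q,z\right)=\sum_{n\ge 0}\frac{(a_1;q)_n(a_2;q)_n(a_3;q)_n(a_4;q)_n}{(q;q)_n(b_1;q)_n(b_2;q)_n(b_3;q)_n}z^n .$$ Let $h_1,h_2,h_3,l_1,l_2,l_3,\alpha\in\mathbb C$ and $t_1,t_2,t_3\in\mathbb C\setminus\{0\}$, and set $\lambda=(h_1+h_2+h_3-l_1-l_2-l_3+1)/2$. Functions of $x\in\mathbb C\setminus\{0\}$ containing powers of $x$ are regarded as functions of $u=\log x\in\mathbb C$, with $x=e^u$ and $x^a=e^{au}$; replacing $x$ by $qx$ or $x/q$ means replacing $u$ by $u+\log q$ or $u-\log q$. Consider the non-homogeneous variant of the $q$-hypergeometric equation of degree three $$\begin{aligned}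 &(x-q^{h_1+1/2}t_1)(x-q^{h_2+1/2}t_2)(x-q^{h_3+1/2}t_3)\,g(x/q)\\ &+q^{2\alpha+1}(x-q^{l_1-1/2}t_1)(x-q^{l_2-1/2}t_2)(x-q^{l_3-1/2}t_3)\,g(qx)\\ &+q^{\alpha}\Bigl[-(q+1)x^3+q^{1/2}\bigl\{(q^{h_1}+q^{l_1})t_1+(q^{h_2}+q^{l_2})t_2+(q^{h_3}+q^{l_3})t_3\bigr\}x^2\\ &\quad-q^{(h_1+h_2+h_3+l_1+l_2+l_3+1)/2}\bigl\{(q^{-h_1}+q^{-l_1})t_2t_3+(q^{-h_2}+q^{-l_2})t_1t_3+(q^{-h_3}+q^{-l_3})t_1t_2\bigr\}x\\ &\quad+q^{(h_1+h_2+h_3+l_1+l_2+l_3)/2}(q+1)t_1t_2t_3\Bigr]g(x) +q^{\alpha}(1-q^{\lambda})x^{\lambda-\alpha+2}=0.\qquad(*) \end{aligned}$$ (i) For every permutation $(i,i',i'')$ of $(1,2,3)$ the function $$\begin{aligned} g_i^{\langle 2\rangle}(x)={}&x^{\lambda-\alpha}\frac{q^{\lambda-h_i-1/2}}{t_i}\,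 \frac{\bigl(xq^{\lambda-h_i+1/2}/t_i,\;q^{h_{i'}-h_i+1}t_{i'}/t_i,\;q^{h_{i''}-h_i+1}t_{i''}/t_i,\;q;q\bigr)_\infty}{\bigl(xq^{-h_i+1/2}/t_i,\;q^{\lambda+l_i-h_i},\;q^{\lambda+l_{i'}-h_i}t_{i'}/t_i,\;q^{\lambda+l_{i''}-h_i}t_{i''}/t_i;q\bigr)_\infty}\\ &\times{}_4\phi_3\!\left({xq^{-h_i+1/2}/t_i,\;q^{\lambda+l_i-h_i},\;q^{\lambda+l_{i'}-h_i}t_{i'}/t_i,\;q^{\lambda+l_{i''}-h_i}t_{i''}/t_i\atop xq^{\lambda-h_i+1/2}/t_i,\;q^{h_{i'}-h_i+1}t_{i'}/t_i,\;q^{h_{i''}-h_i+1}t_{i''}/t_i};q,q\right) \end{aligned}$$ satisfies $(*)$. (ii) The function $$\begin{aligned} g_0^{\langle 2\rangle}(x)={}&x^{\lambda-\alpha-1}\, \frac{\bigl(q^{-\lambda+h_1+3/2}t_1/x,\;q^{-\lambda+h_2+3/2}t_2/x,\;q^{-\lambda+h_3+3/2}t_3/x,\;q;q\bigr)_\infty}{\bigl(q^{l_1+1/2}t_1/x,\;q^{l_2+1/2}t_2/x,\;q^{l_3+1/2}t_3/x,\;q^{1-\lambda};q\bigr)_\infty}\\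 &\times{}_4\phi_3\!\left({q^{l_1+1/2}t_1/x,\;q^{l_2+1/2}t_2/x,\;q^{l_3+1/2}t_3/x,\;q^{1-\lambda}\atop q^{-\lambda+h_1+3/2}t_1/x,\;q^{-\lambda+h_2+3/2}t_2/x,\;q^{-\lambda+h_3+3/2}t_3/x};q,q\right) \end{aligned}$$ satisfies $(*)$. Here the series ${}_4\phi_3$ converges wherever none of the denominators $(\cdot;q)_\infty$ of the prefactor and $(\cdot;q)_n$ of the series vanishes, and $(*)$ holds at every point for which this condition is fulfilled at $x/q$, $x$ and $qx$. -/

import Mathlib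

noncomputable section

namespace QHyp

/-- The complex power `(e^w)^a = e^{a w}` determined by a choice `w` of logarithm.
With `w = L`, where `e^L = q`, it is `q^a`; with `w = u`, where `x = e^u`, it is `x^a`. -/
def cpw (w a : ℂ) : ℂ := Complex.exp (a * w)

/-- The finite `q`-Pochhammer symbol `(a;q)_n = (1-a)(1-aq)⋯(1-aq^{n-1})`. -/
def qPoch (q a : ℂ) (n : ℕ) : ℂ := ∏ j ∈ Finset.range n, (1 - a * q ^ j)

/-- The infinite `q`-Pochhammer symbol `(a;q)_∞ = ∏_{j ≥ 0} (1-aq^j)`. -/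
def qPochInf (q a : ℂ) : ℂ := ∏' j : ℕ, (1 - a * q ^ j)

/-- The infinite product `(a;q)_∞` converges (absolutely) when `|q| < 1`. -/
theorem multipliable_qPochInf {q : ℂ} (hq : ‖q‖ < 1) (a : ℂ) :
    Multipliable fun j : ℕ => 1 - a * q ^ j := by
  have h : Summable fun j : ℕ => ‖-(a * q ^ j)‖ := by
    simp only [norm_neg, norm_mul, norm_pow]
    exact (summable_geometric_of_lt_one (norm_nonneg q) hq).mul_left _
  simpa [sub_eq_add_neg] using multipliable_one_add_of_summable h

/-- The `n`-th term of the series `₄φ₃(a₀,a₁,a₂,a₃; b₀,b₁,b₂; q, z)`. -/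
def phi43Term (q : ℂ) (a : Fin 4 → ℂ) (b : Fin 3 → ℂ) (z : ℂ) (n : ℕ) : ℂ :=
  (∏ k, qPoch q (a k) n) / (qPoch q q n * ∏ k, qPoch q (b k) n) * z ^ n

/-- The basic hypergeometric series `₄φ₃(a₀,a₁,a₂,a₃; b₀,b₁,b₂; q, z)`. -/
def phi43 (q : ℂ) (a : Fin 4 → ℂ) (b : Fin 3 → ℂ) (z : ℂ) : ℂ :=
  ∑' n : ℕ, phi43Term q a b z n

/-- The expression `(b₀,b₁,b₂,q;q)_∞ / (a₀,a₁,a₂,a₃;q)_∞ · ₄φ₃(a; b; q, q)`. -/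
def phi43Normalized (q : ℂ) (a : Fin 4 → ℂ) (b : Fin 3 → ℂ) : ℂ :=
  ((∏ k, qPochInf q (b k)) * qPochInf q q) / (∏ k, qPochInf q (a k)) * phi43 q a b q

/-- No denominator in `phi43Normalized q a b` vanishes: no factor `1 - a_k q^n` of the
products `(a_k;q)_∞` and no factor `1 - b_k q^n` of the symbols `(b_k;q)_n` is zero. -/
def NoZeroDenominators (q : ℂ) (a : Fin 4 → ℂ) (b : Fin 3 → ℂ) : Prop :=
  (∀ (k : Fin 4) (n : ℕ), 1 - a k * q ^ n ≠ 0) ∧ (∀ (k : Fin 3) (n : ℕ), 1 - b k * q ^ n ≠ 0)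

/-! Functions of `x ∈ ℂ \ {0}` which involve powers `x^a` are multivalued. They are written as
functions of `u` with `x = e^u`; replacing `x` by `q x` (by `x / q`) means
replacing `u` by `u + L` (by `u - L`), where `e^L = q`. -/

/-- Upper parameters of the `₄φ₃` in `g_i^{⟨2⟩}` at `x = e^u`. -/
def upperG (L lam : ℂ) (h l t : Fin 3 → ℂ) (i i' i'' : Fin 3) (u : ℂ) : Fin 4 → ℂ :=
  ![Complex.exp u * cpw L (-h i + 1 / 2) / t i,
    cpw L (lam + l i - h i),
    cpw L (lam + l i' - h i) * t i' / t i,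
    cpw L (lam + l i'' - h i) * t i'' / t i]

/-- Lower parameters of the `₄φ₃` in `g_i^{⟨2⟩}` at `x = e^u`. -/
def lowerG (L lam : ℂ) (h t : Fin 3 → ℂ) (i i' i'' : Fin 3) (u : ℂ) : Fin 3 → ℂ :=
  ![Complex.exp u * cpw L (lam - h i + 1 / 2) / t i,
    cpw L (h i' - h i + 1) * t i' / t i,
    cpw L (h i'' - h i + 1) * t i'' / t i]

/-- The function `g_i^{⟨2⟩}(x)`, `x = e^u`, for a permutation `(i, i', i'')` of the indices. -/
def gI (q L lam α : ℂ) (h l t : Fin 3 → ℂ) (i i' i'' : Fin 3) (u : ℂ) : ℂ :=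
  cpw u (lam - α) * (cpw L (lam - h i - 1 / 2) / t i) *
    phi43Normalized q (upperG L lam h l t i i' i'' u) (lowerG L lam h t i i' i'' u)

/-- Upper parameters of the `₄φ₃` in `g_0^{⟨2⟩}` at `x = e^u`. -/
def upperZero (L lam : ℂ) (l t : Fin 3 → ℂ) (u : ℂ) : Fin 4 → ℂ :=
  ![cpw L (l 0 + 1 / 2) * t 0 / Complex.exp u,
    cpw L (l 1 + 1 / 2) * t 1 / Complex.exp u,
    cpw L (l 2 + 1 / 2) * t 2 / Complex.exp u,
    cpw L (1 - lam)]

/-- Lower parameters of the `₄φ₃` in `g_0^{⟨2⟩}` at `x = e^u`. -/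
def lowerZero (L lam : ℂ) (h t : Fin 3 → ℂ) (u : ℂ) : Fin 3 → ℂ :=
  ![cpw L (-lam + h 0 + 3 / 2) * t 0 / Complex.exp u,
    cpw L (-lam + h 1 + 3 / 2) * t 1 / Complex.exp u,
    cpw L (-lam + h 2 + 3 / 2) * t 2 / Complex.exp u]

/-- The function `g_0^{⟨2⟩}(x)`, `x = e^u`. -/
def gZero (q L lam α : ℂ) (h l t : Fin 3 → ℂ) (u : ℂ) : ℂ :=
  cpw u (lam - α - 1) * phi43Normalized q (upperZero L lam l t u) (lowerZero L lam h t u)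

/-- The left-hand side, at `x = e^u`, of the (homogeneous) variant of the `q`-hypergeometric
equation of degree three for a function `g`. -/
def variantDegThree (q L α : ℂ) (h l t : Fin 3 → ℂ) (g : ℂ → ℂ) (u : ℂ) : ℂ :=
  let x : ℂ := Complex.exp u
  (x - cpw L (h 0 + 1 / 2) * t 0) * (x - cpw L (h 1 + 1 / 2) * t 1) *
      (x - cpw L (h 2 + 1 / 2) * t 2) * g (u - L)
    + cpw L (2 * α + 1) * ((x - cpw L (l 0 - 1 / 2) * t 0) * (x - cpw L (l 1 - 1 / 2) * t 1) *
      (x - cpw L (l 2 - 1 / 2) * t 2)) * g (u + L)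
    + cpw L α *
      (-(q + 1) * x ^ 3
        + cpw L (1 / 2) * ((cpw L (h 0) + cpw L (l 0)) * t 0 + (cpw L (h 1) + cpw L (l 1)) * t 1
            + (cpw L (h 2) + cpw L (l 2)) * t 2) * x ^ 2
        - cpw L ((h 0 + h 1 + h 2 + l 0 + l 1 + l 2 + 1) / 2) *
            ((cpw L (-h 0) + cpw L (-l 0)) * t 1 * t 2
              + (cpw L (-h 1) + cpw L (-l 1)) * t 0 * t 2
              + (cpw L (-h 2) + cpw L (-l 2)) * t 0 * t 1) * x
        + cpw L ((h 0 + h 1 + h 2 + l 0 + l 1 + l 2) / 2) * (q + 1) * t 0 * t 1 * t 2) * g u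

/-- `g` satisfies, at `x = e^u`, the non-homogeneous version of the variant of the
`q`-hypergeometric equation of degree three with additional term
`q^α (1 - q^λ) x^{λ - α + 2}`. -/
def SolvesNonHomAt (q L lam α : ℂ) (h l t : Fin 3 → ℂ) (g : ℂ → ℂ) (u : ℂ) : Prop :=
  variantDegThree q L α h l t g u + cpw L α * (1 - cpw L lam) * cpw u (lam - α + 2) = 0

end QHyp

end

/-! Put `a j = q^{h_j+1/2} t_j`, `b j = q^{l_j-1/2} t_j` and `m = q^λ`; the choice of `λ` says
exactly that `m² q² b₀b₁b₂ = a₀a₁a₂`. Because `(c;q)_n (cq^n;q)_∞ = (c;q)_∞`, each normalized `₄φ₃`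
is, up to an elementary factor, a Jackson sum of `jacksonTerm` over the points `s q^n`. The start
`s` makes one numerator product equal to `(q^{n+1};q)_∞`: `s = q / a_i` for `g_i`, and `s = q / (m
x)` for `g_0`.

Once the power `x^{λ-α}` is divided out, the operator in `x` sends `jacksonTerm` to a `q`-difference
in `s` of `jacksonPrimitive` (`jacksonTerm_telescopes`), so the sum reduces to its two ends. The end
`s → 0` contributes `-(q(1-m)/m) x²`, which is the source of the non-homogeneous term. At the other
end, `s = q / a_i` gives a factor `(1;q)_∞ = 0`. The start `q / (m x)` moves with `x`, so the three
sums are misaligned by one step each; the unmatched initial terms cancel the boundary value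
(`jackson_boundary`). -/

noncomputable section

namespace QHyp

open Filter Topology

/-! ### Infinite `q`-products and convergence of the series. -/

theorem qPochInf_eq_mul {q : ℂ} (hq : ‖q‖ < 1) (a : ℂ) :
    qPochInf q a = (1 - a) * qPochInf q (a * q) := by
  have h : Multipliable fun j : ℕ => 1 - a * q ^ (j + 1) := by
    simpa [pow_succ', mul_assoc] using multipliable_qPochInf hq (a * q)
  have := tprod_eq_zero_mul' (f := fun j : ℕ => 1 - a * q ^ j) h
  simpa [qPochInf, pow_succ', mul_assoc] using this

theorem qPoch_mul_qPochInf {q : ℂ} (hq : ‖q‖ < 1) (a : ℂ) (n : ℕ) :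
    qPoch q a n * qPochInf q (a * q ^ n) = qPochInf q a := by
  induction n with
  | zero => simp [qPoch]
  | succ n ih =>
    rw [← ih, qPochInf_eq_mul hq (a * q ^ n), qPoch, Finset.prod_range_succ, qPoch, pow_succ]
    ring_nf

theorem qPochInf_ne_zero {q a : ℂ} (hq : ‖q‖ < 1) (h : ∀ n : ℕ, 1 - a * q ^ n ≠ 0) :
    qPochInf q a ≠ 0 := by
  have hs : Summable fun j : ℕ => ‖-(a * q ^ j)‖ := by
    simp only [norm_neg, norm_mul, norm_pow]
    exact (summable_geometric_of_lt_one (norm_nonneg q) hq).mul_left _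
  have := tprod_one_add_ne_zero_of_summable (f := fun j : ℕ => -(a * q ^ j))
    (fun i => by simpa [sub_eq_add_neg] using h i) hs
  simpa [qPochInf, sub_eq_add_neg] using this

theorem tendsto_qPoch {q : ℂ} (hq : ‖q‖ < 1) (a : ℂ) :
    Tendsto (qPoch q a) atTop (𝓝 (qPochInf q a)) :=
  (multipliable_qPochInf hq a).tendsto_prod_tprod_nat

theorem tendsto_qPochInf {q : ℂ} (hq : ‖q‖ < 1) (a : ℂ) :
    Tendsto (fun n : ℕ => qPochInf q (a * q ^ n)) atTop (𝓝 1) := by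
  have h0 : Tendsto (fun n : ℕ => a * q ^ n) atTop (𝓝 0) := by
    simpa using (tendsto_pow_atTop_nhds_zero_of_norm_lt_one hq).const_mul a
  have h1 : ∀ᶠ n : ℕ in atTop, a * q ^ n ≠ 1 := h0.eventually_ne zero_ne_one
  -- `(a;q)_∞` itself may vanish. Past `N` no factor is zero, and the tail is the quotient of
  -- `(aq^N;q)_∞` by its partial products.
  obtain ⟨N, hN⟩ := eventually_atTop.1 h1
  rw [← tendsto_add_atTop_iff_nat N]
  have hb : ∀ n : ℕ, 1 - a * q ^ N * q ^ n ≠ 0 := fun n => by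
    rw [mul_assoc, ← pow_add, sub_ne_zero]
    exact (hN _ (Nat.le_add_right _ _)).symm
  have hne := qPochInf_ne_zero hq hb
  have h2 := (tendsto_const_nhds (x := qPochInf q (a * q ^ N))).div
    (tendsto_qPoch hq (a * q ^ N)) hne
  rw [div_self hne] at h2
  refine h2.congr fun n => ?_
  have h3 := qPoch_mul_qPochInf hq (a * q ^ N) n
  have h4 : qPoch q (a * q ^ N) n ≠ 0 := Finset.prod_ne_zero_iff.2 fun j _ => hb j
  rw [Pi.div_apply, div_eq_iff h4, ← h3, pow_add]
  ring_nf

theorem one_sub_mul_pow_self_ne_zero {q : ℂ} (hq : ‖q‖ < 1) (n : ℕ) : 1 - q * q ^ n ≠ 0 := by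
  rw [sub_ne_zero, ← pow_succ']
  intro h
  have : ‖q‖ ^ (n + 1) < 1 := pow_lt_one₀ (norm_nonneg q) hq (Nat.succ_ne_zero n)
  rw [← norm_pow, ← h] at this
  simp at this

/-- The coefficient of `q^n` converges to a quotient of infinite products, hence is bounded, and a
geometric series dominates. -/
theorem summable_phi43Term {q : ℂ} (hq : ‖q‖ < 1) {a : Fin 4 → ℂ} {b : Fin 3 → ℂ}
    (h : NoZeroDenominators q a b) : Summable (phi43Term q a b q) := by
  have hlim : Tendsto (fun n : ℕ => (∏ k, qPoch q (a k) n) / (qPoch q q n * ∏ k, qPoch q (b k) n))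
      atTop (𝓝 ((∏ k, qPochInf q (a k)) / (qPochInf q q * ∏ k, qPochInf q (b k)))) := by
    refine Tendsto.div (tendsto_finsetProd _ fun k _ => tendsto_qPoch hq _)
      ((tendsto_qPoch hq q).mul (tendsto_finsetProd _ fun k _ => tendsto_qPoch hq _)) ?_
    exact mul_ne_zero (qPochInf_ne_zero hq (one_sub_mul_pow_self_ne_zero hq))
      (Finset.prod_ne_zero_iff.2 fun k _ => qPochInf_ne_zero hq (h.2 k))
  have hO := (hlim.isBigO_one ℝ).mul
    (Asymptotics.isBigO_refl (fun n : ℕ => q ^ n) atTop).norm_right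
  refine summable_of_isBigO_nat (g := fun n => ‖q‖ ^ n)
    (summable_geometric_of_lt_one (norm_nonneg q) hq) ?_
  change (fun n => phi43Term q a b q n) =O[atTop] _
  simpa [phi43Term] using hO

/-- The normalized series as a Jackson type sum. -/
theorem hasSum_phi43Normalized {q : ℂ} (hq : ‖q‖ < 1) {a : Fin 4 → ℂ} {b : Fin 3 → ℂ}
    (h : NoZeroDenominators q a b) :
    HasSum (fun n : ℕ => q ^ n * ((∏ k, qPochInf q (b k * q ^ n)) * qPochInf q (q * q ^ n)) /
      ∏ k, qPochInf q (a k * q ^ n)) (phi43Normalized q a b) := by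
  refine ((summable_phi43Term hq h).hasSum.mul_left
    (((∏ k, qPochInf q (b k)) * qPochInf q q) / (∏ k, qPochInf q (a k)))).congr_fun ?_
  intro n
  have hA : ∏ k, qPochInf q (a k) ≠ 0 :=
    Finset.prod_ne_zero_iff.2 fun k _ => qPochInf_ne_zero hq (h.1 k)
  have ha : (∏ k, qPoch q (a k) n) * ∏ k, qPochInf q (a k * q ^ n) = ∏ k, qPochInf q (a k) := by
    rw [← Finset.prod_mul_distrib]
    exact Finset.prod_congr rfl fun k _ => qPoch_mul_qPochInf hq _ _
  have hb : (∏ k, qPoch q (b k) n) * ∏ k, qPochInf q (b k * q ^ n) = ∏ k, qPochInf q (b k) := by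
    rw [← Finset.prod_mul_distrib]
    exact Finset.prod_congr rfl fun k _ => qPoch_mul_qPochInf hq _ _
  have hb0 : ∏ k, qPoch q (b k) n ≠ 0 :=
    Finset.prod_ne_zero_iff.2 fun k _ => Finset.prod_ne_zero_iff.2 fun j _ => h.2 k j
  have hq0 : qPoch q q n ≠ 0 :=
    Finset.prod_ne_zero_iff.2 fun j _ => one_sub_mul_pow_self_ne_zero hq j
  rw [← ha] at hA
  rw [phi43Term, ← ha, ← hb, ← qPoch_mul_qPochInf hq q n]
  have h1 := left_ne_zero_of_mul hA
  have h2 := right_ne_zero_of_mul hA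
  field_simp

/-! ### Jackson sums and the telescoping identity. -/

/-- The coefficient of `g(x)` in the variant of degree three, divided by `q^α`, with
`a_j = q^{h_j+1/2} t_j`, `b_j = q^{l_j-1/2} t_j` and `m = q^λ`. -/
def middleCoeff (q m x : ℂ) (a b : Fin 3 → ℂ) : ℂ :=
  -(q + 1) * x ^ 3 + (a 0 + a 1 + a 2 + q * (b 0 + b 1 + b 2)) * x ^ 2
    - (m * q * (b 1 * b 2 + b 0 * b 2 + b 0 * b 1)
      + (a 1 * a 2 + a 0 * a 2 + a 0 * a 1) / m) * x
    + m * q * (q + 1) * (b 0 * b 1 * b 2)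

/-- The integrand of the Jackson integral which represents the solutions. -/
def jacksonTerm (q m : ℂ) (a b : Fin 3 → ℂ) (x s : ℂ) : ℂ :=
  s * (qPochInf q (m * x * s) * ∏ j, qPochInf q (a j * s)) /
    (qPochInf q (x * s) * ∏ j, qPochInf q (m * b j * s))

/-- The function whose `q`-difference is the equation applied to `jacksonTerm`. -/
def jacksonPrimitive (q m : ℂ) (a b : Fin 3 → ℂ) (x s : ℂ) : ℂ :=
  -(q * (1 - m) / m * x ^ 2) * (qPochInf q (m * x * s) * ∏ j, qPochInf q (a j * (s / q))) /
    (qPochInf q (x * (s / q)) * ∏ j, qPochInf q (m * b j * s))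

/-- Shifting `x` or `s` by `q` changes each infinite product only by finitely many linear factors.
Dividing by the common tails leaves the rational identity `key`, which holds modulo `hab`. -/
theorem jacksonTerm_telescopes {q m x s : ℂ} {a b : Fin 3 → ℂ} (hq : ‖q‖ < 1) (hq0 : q ≠ 0)
    (hm : m ≠ 0) (hab : m ^ 2 * q ^ 2 * (b 0 * b 1 * b 2) = a 0 * a 1 * a 2)
    (hx : qPochInf q (x * (s / q)) ≠ 0) (hb : ∀ j, qPochInf q (m * b j * s) ≠ 0) :
    m⁻¹ * ((x - a 0) * (x - a 1) * (x - a 2)) * jacksonTerm q m a b (x / q) s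
      + m * q * ((x - b 0) * (x - b 1) * (x - b 2)) * jacksonTerm q m a b (q * x) s
      + middleCoeff q m x a b * jacksonTerm q m a b x s
      = jacksonPrimitive q m a b x (s * q) - jacksonPrimitive q m a b x s := by
  have hM := qPochInf_eq_mul hq
  have e1 : qPochInf q (x * (s / q)) = (1 - x * s / q) * ((1 - x * s) * qPochInf q (x * s * q)) := by
    rw [hM (x * (s / q)), show x * (s / q) * q = x * s by field_simp, hM (x * s), mul_div_assoc]
  have e2 : qPochInf q (m * (x / q) * s) =
      (1 - m * x * s / q) * ((1 - m * x * s) * qPochInf q (m * x * s * q)) := by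
    rw [hM (m * (x / q) * s), show m * (x / q) * s * q = m * x * s by field_simp, hM (m * x * s),
      show m * (x / q) * s = m * x * s / q by ring]
  have e3 : ∀ j, qPochInf q (a j * (s / q)) = (1 - a j * s / q) * qPochInf q (a j * s) := fun j => by
    rw [hM (a j * (s / q)), show a j * (s / q) * q = a j * s by field_simp, mul_div_assoc]
  simp only [jacksonTerm, jacksonPrimitive, Fin.prod_univ_three, middleCoeff]
  have f1 : x / q * s = x * (s / q) := by field_simp
  have f2 : q * x * s = x * s * q := by ring
  have f3 : m * (q * x) * s = m * x * s * q := by ring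
  have f4 : ∀ j, a j * (s * q / q) = a j * s := fun j => by field_simp
  have f5 : ∀ j, m * b j * (s * q) = m * b j * s * q := fun j => by ring
  have f6 : x * (s * q / q) = x * s := by field_simp
  have f7 : m * x * (s * q) = m * x * s * q := by ring
  rw [f1, f2, f3, f4, f4, f4, f5, f5, f5, f6, f7, e1, e2, e3, e3, e3,
    hM (m * x * s), hM (x * s)]
  rw [e1] at hx
  have b0 := hb 0
  have b1 := hb 1
  have b2 := hb 2
  rw [hM] at b0 b1 b2
  rw [hM (m * b 0 * s), hM (m * b 1 * s), hM (m * b 2 * s)]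
  generalize qPochInf q (m * b 0 * s * q) = B0 at *
  generalize qPochInf q (m * b 1 * s * q) = B1 at *
  generalize qPochInf q (m * b 2 * s * q) = B2 at *
  generalize qPochInf q (a 0 * s) = A0 at *
  generalize qPochInf q (a 1 * s) = A1 at *
  generalize qPochInf q (a 2 * s) = A2 at *
  generalize qPochInf q (x * s * q) = X at *
  generalize qPochInf q (m * x * s * q) = Y at *
  generalize a 0 = a0 at *
  generalize a 1 = a1 at *
  generalize a 2 = a2 at *
  generalize b 0 = y0 at *
  generalize b 1 = y1 at *
  generalize b 2 = y2 at *
  have hX1 := left_ne_zero_of_mul hx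
  have hX2 := left_ne_zero_of_mul (right_ne_zero_of_mul hx)
  have hX3 := right_ne_zero_of_mul (right_ne_zero_of_mul hx)
  have g0 := left_ne_zero_of_mul b0
  have g1 := left_ne_zero_of_mul b1
  have g2 := left_ne_zero_of_mul b2
  have k0 := right_ne_zero_of_mul b0
  have k1 := right_ne_zero_of_mul b1
  have k2 := right_ne_zero_of_mul b2
  have key : s * (m⁻¹ * ((x - a0) * (x - a1) * (x - a2)) * ((1 - m * x * s / q) * (1 - m * x * s))
        + m * q * ((x - y0) * (x - y1) * (x - y2)) * ((1 - x * s / q) * (1 - x * s))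
        + (-(q + 1) * x ^ 3 + (a0 + a1 + a2 + q * (y0 + y1 + y2)) * x ^ 2
          - (m * q * (y1 * y2 + y0 * y2 + y0 * y1) + (a1 * a2 + a0 * a2 + a0 * a1) / m) * x
          + m * q * (q + 1) * (y0 * y1 * y2)) * ((1 - m * x * s) * (1 - x * s / q)))
      = -(q * (1 - m) / m * x ^ 2) *
        ((1 - x * s / q) * ((1 - m * y0 * s) * (1 - m * y1 * s) * (1 - m * y2 * s))
        - (1 - m * x * s) * ((1 - a0 * s / q) * (1 - a1 * s / q) * (1 - a2 * s / q))) := by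
    -- The multiplier of `hab` is minus the coefficient of `a0 * a1 * a2` in the difference of the
    -- two sides, so it trades that product for `m² q² y0 y1 y2`.
    linear_combination (norm := skip) (s / m * (1 - m * x * s / q) * (1 - m * x * s)
      - (1 - m) / (m * q ^ 2) * x ^ 2 * s ^ 3 * (1 - m * x * s)) * hab
    field_simp
    ring
  have lhs := congrArg (fun w => w * (Y * (A0 * A1 * A2)) / ((1 - x * s / q) * (1 - x * s) * X *
    ((1 - m * y0 * s) * B0 * ((1 - m * y1 * s) * B1) * ((1 - m * y2 * s) * B2)))) key
  refine Eq.trans ?_ (lhs.trans ?_)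
  · generalize 1 - x * s / q = Z1 at *
    generalize 1 - x * s = Z2 at *
    generalize 1 - m * y0 * s = G0 at *
    generalize 1 - m * y1 * s = G1 at *
    generalize 1 - m * y2 * s = G2 at *
    field_simp
  · generalize 1 - x * s / q = Z1 at *
    generalize 1 - x * s = Z2 at *
    generalize 1 - m * y0 * s = G0 at *
    generalize 1 - m * y1 * s = G1 at *
    generalize 1 - m * y2 * s = G2 at *
    field_simp
    ring

/-- All the infinite products tend to `1` as their arguments tend to `0`, so only the prefactor
survives. -/
theorem tendsto_jacksonPrimitive {q : ℂ} (hq : ‖q‖ < 1) (m : ℂ) (a b : Fin 3 → ℂ) (x s : ℂ) :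
    Tendsto (fun n : ℕ => jacksonPrimitive q m a b x (s * q ^ n)) atTop
      (𝓝 (-(q * (1 - m) / m * x ^ 2))) := by
  have hT := tendsto_qPochInf hq
  have := ((hT (m * x * s)).mul (tendsto_finsetProd Finset.univ fun j _ => hT (a j * (s / q)))).div
    ((hT (x * (s / q))).mul (tendsto_finsetProd Finset.univ fun j _ => hT (m * b j * s)))
    (by simp)
  have := this.const_mul (-(q * (1 - m) / m * x ^ 2))
  simp only [Finset.prod_const_one, mul_one, div_one] at this
  refine this.congr fun n => ?_
  have f : ∀ c : ℂ, c * (s * q ^ n) = c * s * q ^ n := fun c => by ring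
  have f' : ∀ c : ℂ, c * (s * q ^ n / q) = c * (s / q) * q ^ n := fun c => by ring
  simp only [jacksonPrimitive, f, f', Pi.div_apply]
  exact (mul_div_assoc _ _ _).symm

theorem jackson_sum_equation {q m x s S₁ S₂ S₃ : ℂ} {a b : Fin 3 → ℂ} (hq : ‖q‖ < 1) (hq0 : q ≠ 0)
    (hm : m ≠ 0) (hab : m ^ 2 * q ^ 2 * (b 0 * b 1 * b 2) = a 0 * a 1 * a 2)
    (hx : ∀ n : ℕ, qPochInf q (x * (s * q ^ n / q)) ≠ 0)
    (hb : ∀ j, ∀ n : ℕ, qPochInf q (m * b j * (s * q ^ n)) ≠ 0)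
    (h₁ : HasSum (fun n : ℕ => jacksonTerm q m a b (x / q) (s * q ^ n)) S₁)
    (h₂ : HasSum (fun n : ℕ => jacksonTerm q m a b (q * x) (s * q ^ n)) S₂)
    (h₃ : HasSum (fun n : ℕ => jacksonTerm q m a b x (s * q ^ n)) S₃) :
    m⁻¹ * ((x - a 0) * (x - a 1) * (x - a 2)) * S₁
      + m * q * ((x - b 0) * (x - b 1) * (x - b 2)) * S₂
      + middleCoeff q m x a b * S₃
      = -(q * (1 - m) / m * x ^ 2) - jacksonPrimitive q m a b x s := by
  have h := ((h₁.mul_left (m⁻¹ * ((x - a 0) * (x - a 1) * (x - a 2)))).add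
    (h₂.mul_left (m * q * ((x - b 0) * (x - b 1) * (x - b 2))))).add
    (h₃.mul_left (middleCoeff q m x a b))
  have h' := (tendsto_jacksonPrimitive hq m a b x s).sub_const (jacksonPrimitive q m a b x s)
  refine tendsto_nhds_unique h.tendsto_sum_nat (h'.congr fun N => ?_)
  have := Finset.sum_range_sub (fun n : ℕ => jacksonPrimitive q m a b x (s * q ^ n)) N
  rw [pow_zero, mul_one] at this
  rw [← this]
  refine Finset.sum_congr rfl fun n _ => ?_
  rw [jacksonTerm_telescopes hq hq0 hm hab (hx n) (fun j => hb j n), pow_succ, mul_assoc s]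

/-- Formally this is the telescoping over `s = 1/(mx)` and `s = q/(mx)`: the absent terms and the
primitive at `1/(mx)` contain a vanishing numerator product. Telescoping itself would need
`(1/(mq);q)_∞ ≠ 0`, whereas only `(q/m;q)_∞ ≠ 0` is available, so the identity is verified directly.
-/
theorem jackson_boundary {q m x : ℂ} {a b : Fin 3 → ℂ} (hq : ‖q‖ < 1) (hq0 : q ≠ 0)
    (hm : m ≠ 0) (hx0 : x ≠ 0) (hab : m ^ 2 * q ^ 2 * (b 0 * b 1 * b 2) = a 0 * a 1 * a 2)
    (hx : qPochInf q (q / m) ≠ 0)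
    (hb : ∀ j, qPochInf q (b j / x) ≠ 0) :
    m * q * ((x - b 0) * (x - b 1) * (x - b 2)) *
        (jacksonTerm q m a b (q * x) (1 / (m * x)) + jacksonTerm q m a b (q * x) (q / (m * x)))
      + middleCoeff q m x a b * jacksonTerm q m a b x (q / (m * x))
      = jacksonPrimitive q m a b x (q ^ 2 / (m * x)) := by
  have hM := qPochInf_eq_mul hq
  simp only [jacksonTerm, jacksonPrimitive, Fin.prod_univ_three, middleCoeff]
  have e1 : m * (q * x) * (1 / (m * x)) = q := by field_simp
  have e2 : q * x * (1 / (m * x)) = q / m := by field_simp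
  have e3 : ∀ j, m * b j * (1 / (m * x)) = b j / x := fun j => by field_simp
  have e4 : m * (q * x) * (q / (m * x)) = q * q := by field_simp
  have e5 : q * x * (q / (m * x)) = q / m * q := by field_simp
  have e6 : ∀ j, m * b j * (q / (m * x)) = b j / x * q := fun j => by field_simp
  have e7 : m * x * (q / (m * x)) = q := by field_simp
  have e8 : x * (q / (m * x)) = q / m := by field_simp
  have e9 : m * x * (q ^ 2 / (m * x)) = q * q := by field_simp
  have e10 : x * (q ^ 2 / (m * x) / q) = q / m := by field_simp
  have e11 : ∀ j, m * b j * (q ^ 2 / (m * x)) = b j / x * q * q := fun j => by field_simp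
  have e12 : ∀ j, a j * (q ^ 2 / (m * x) / q) = a j / (m * x) * q := fun j => by field_simp
  have e13 : ∀ j, a j * (q / (m * x)) = a j / (m * x) * q := fun j => by field_simp
  have e14 : ∀ j, a j * (1 / (m * x)) = a j / (m * x) := fun j => by field_simp
  simp only [e1, e2, e3, e4, e5, e6, e7, e8, e9, e10, e11, e12, e13, e14]
  have hb' : ∀ j, qPochInf q (b j / x) =
      (1 - b j / x) * ((1 - b j / x * q) * qPochInf q (b j / x * q * q)) := fun j => by
    rw [hM (b j / x), hM (b j / x * q)]
  have b0 := hb 0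
  have b1 := hb 1
  have b2 := hb 2
  rw [hb'] at b0 b1 b2
  rw [hM] at hx
  rw [hb' 0, hb' 1, hb' 2, hM (b 0 / x * q), hM (b 1 / x * q), hM (b 2 / x * q), hM q,
    hM (q / m), hM (a 0 / (m * x)), hM (a 1 / (m * x)), hM (a 2 / (m * x))]
  generalize qPochInf q (b 0 / x * q * q) = B0 at *
  generalize qPochInf q (b 1 / x * q * q) = B1 at *
  generalize qPochInf q (b 2 / x * q * q) = B2 at *
  generalize qPochInf q (a 0 / (m * x) * q) = A0 at *
  generalize qPochInf q (a 1 / (m * x) * q) = A1 at *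
  generalize qPochInf q (a 2 / (m * x) * q) = A2 at *
  generalize qPochInf q (q / m * q) = X at *
  generalize qPochInf q (q * q) = Y at *
  generalize a 0 = a0 at *
  generalize a 1 = a1 at *
  generalize a 2 = a2 at *
  generalize b 0 = y0 at *
  generalize b 1 = y1 at *
  generalize b 2 = y2 at *
  have hX1 := left_ne_zero_of_mul hx
  have hX2 := right_ne_zero_of_mul hx
  have g0 := left_ne_zero_of_mul b0
  have g1 := left_ne_zero_of_mul b1
  have g2 := left_ne_zero_of_mul b2
  have k0 := left_ne_zero_of_mul (right_ne_zero_of_mul b0)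
  have k1 := left_ne_zero_of_mul (right_ne_zero_of_mul b1)
  have k2 := left_ne_zero_of_mul (right_ne_zero_of_mul b2)
  have l0 := right_ne_zero_of_mul (right_ne_zero_of_mul b0)
  have l1 := right_ne_zero_of_mul (right_ne_zero_of_mul b1)
  have l2 := right_ne_zero_of_mul (right_ne_zero_of_mul b2)
  have key : m * q * x ^ 3 * (1 / (m * x)) * ((1 - q) *
          ((1 - a0 / (m * x)) * (1 - a1 / (m * x)) * (1 - a2 / (m * x))))
        + q / (m * x) * (m * q * ((x - y0) * (x - y1) * (x - y2)) * (1 - q / m)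
        + (-(q + 1) * x ^ 3 + (a0 + a1 + a2 + q * (y0 + y1 + y2)) * x ^ 2
          - (m * q * (y1 * y2 + y0 * y2 + y0 * y1) + (a1 * a2 + a0 * a2 + a0 * a1) / m) * x
          + m * q * (q + 1) * (y0 * y1 * y2)) * (1 - q))
      = -(q * (1 - m) / m * x ^ 2) *
        ((1 - y0 / x * q) * (1 - y1 / x * q) * (1 - y2 / x * q)) := by
    linear_combination (norm := skip) (q * (1 - q) / (m ^ 3 * x)) * hab
    field_simp
    ring
  -- In the term at `s = 1/(mx)` these factors cancel the leading factors of the products `(b j / x;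
  -- q)_∞`.
  have hf : (x - y0) * (x - y1) * (x - y2) = x ^ 3 * ((1 - y0 / x) * (1 - y1 / x) * (1 - y2 / x)) := by
    field_simp
  have lhs := congrArg (fun w => w * (Y * (A0 * A1 * A2)) / ((1 - q / m) * X *
    ((1 - y0 / x * q) * B0 * ((1 - y1 / x * q) * B1) * ((1 - y2 / x * q) * B2)))) key
  refine Eq.trans ?_ (lhs.trans ?_)
  · rw [mul_add (m * q * ((x - y0) * (x - y1) * (x - y2))), hf]
    generalize 1 - q / m = Z1 at *
    generalize 1 - y0 / x * q = G0 at *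
    generalize 1 - y1 / x * q = G1 at *
    generalize 1 - y2 / x * q = G2 at *
    generalize 1 - y0 / x = H0 at *
    generalize 1 - y1 / x = H1 at *
    generalize 1 - y2 / x = H2 at *
    generalize 1 - a0 / (m * x) = I0 at *
    generalize 1 - a1 / (m * x) = I1 at *
    generalize 1 - a2 / (m * x) = I2 at *
    field_simp
    ring
  · generalize 1 - q / m = Z1 at *
    generalize 1 - y0 / x * q = G0 at *
    generalize 1 - y1 / x * q = G1 at *
    generalize 1 - y2 / x * q = G2 at *
    field_simp

/-! ### The two choices of endpoint. -/

theorem qPochInf_mul_pow_ne_zero {q a : ℂ} (hq : ‖q‖ < 1) (h : ∀ n : ℕ, 1 - a * q ^ n ≠ 0)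
    (n : ℕ) : qPochInf q (a * q ^ n) ≠ 0 :=
  qPochInf_ne_zero hq fun j => by rw [mul_assoc, ← pow_add]; exact h _

/-- The solution whose Jackson integral starts at the fixed point `s = q / a_0`. -/
theorem equation_of_fixed_endpoint {q m x s : ℂ} {a b : Fin 3 → ℂ} (hq : ‖q‖ < 1) (hq0 : q ≠ 0)
    (hm : m ≠ 0) (hab : m ^ 2 * q ^ 2 * (b 0 * b 1 * b 2) = a 0 * a 1 * a 2) (hs : a 0 * s = q)
    {N : ℂ → ℂ}
    (hN : ∀ y, N y = phi43Normalized q ![y * s, m * b 0 * s, m * b 1 * s, m * b 2 * s]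
      ![m * y * s, a 1 * s, a 2 * s])
    (h : ∀ y ∈ ({x / q, x, q * x} : Set ℂ),
      NoZeroDenominators q ![y * s, m * b 0 * s, m * b 1 * s, m * b 2 * s]
        ![m * y * s, a 1 * s, a 2 * s]) :
    m⁻¹ * ((x - a 0) * (x - a 1) * (x - a 2)) * (m * s / q * N (x / q))
      + m * q * ((x - b 0) * (x - b 1) * (x - b 2)) * (m * s / q * N (q * x))
      + middleCoeff q m x a b * (m * s / q * N x) + (1 - m) * x ^ 2 = 0 := by
  have hsum : ∀ y ∈ ({x / q, x, q * x} : Set ℂ),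
      HasSum (fun n : ℕ => jacksonTerm q m a b y (s * q ^ n)) (s * N y) := fun y hy => by
    rw [hN]
    refine ((hasSum_phi43Normalized hq (h y hy)).mul_left s).congr_fun fun n => ?_
    simp only [jacksonTerm, Fin.prod_univ_three, Fin.prod_univ_four, Matrix.cons_val, ← mul_assoc,
      hs]
    ring
  have key := jackson_sum_equation (s := s) hq hq0 hm hab (x := x)
    -- The primitive has `x * (s / q)` in its denominator, so its non-vanishing is the condition at
    -- the point `x / q`.
    (fun n => by
      have := qPochInf_mul_pow_ne_zero hq ((h (x / q) (by simp)).1 0) n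
      rwa [Matrix.cons_val_zero, show x / q * s * q ^ n = x * (s * q ^ n / q) by ring] at this)
    (fun j n => by
      have := fun k => qPochInf_mul_pow_ne_zero hq ((h x (by simp)).1 k) n
      rw [← mul_assoc]
      fin_cases j
      · exact this 1
      · exact this 2
      · exact this 3)
    (hsum _ (by simp)) (hsum _ (by simp)) (hsum _ (by simp))
  -- Since `a 0 * (s / q) = 1`, the numerator contains `(1;q)_∞`.
  have h0 : jacksonPrimitive q m a b x s = 0 := by
    have : qPochInf q (a 0 * (s / q)) = 0 := by
      rw [← mul_div_assoc, hs, div_self hq0, qPochInf_eq_mul hq]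
      simp
    simp [jacksonPrimitive, Fin.prod_univ_three, this]
  rw [h0] at key
  linear_combination (norm := skip) m / q * key
  field_simp
  ring

/-- The solution whose Jackson integral starts at the moving point `s = q / (m x)`. -/
theorem equation_of_moving_endpoint {q m x : ℂ} {a b : Fin 3 → ℂ} (hq : ‖q‖ < 1) (hq0 : q ≠ 0)
    (hm : m ≠ 0) (hx0 : x ≠ 0) (hab : m ^ 2 * q ^ 2 * (b 0 * b 1 * b 2) = a 0 * a 1 * a 2)
    {N : ℂ → ℂ}
    (hN : ∀ y, N y = phi43Normalized q ![q * b 0 / y, q * b 1 / y, q * b 2 / y, q / m]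
      ![a 0 * q / (m * y), a 1 * q / (m * y), a 2 * q / (m * y)])
    (h : ∀ y ∈ ({x / q, x, q * x} : Set ℂ),
      NoZeroDenominators q ![q * b 0 / y, q * b 1 / y, q * b 2 / y, q / m]
        ![a 0 * q / (m * y), a 1 * q / (m * y), a 2 * q / (m * y)]) :
    m⁻¹ * ((x - a 0) * (x - a 1) * (x - a 2)) * (N (x / q) / (x / q))
      + m * q * ((x - b 0) * (x - b 1) * (x - b 2)) * (N (q * x) / (q * x))
      + middleCoeff q m x a b * (N x / x) + (1 - m) * x ^ 2 = 0 := by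
  have hsum : ∀ y ∈ ({x / q, x, q * x} : Set ℂ), y ≠ 0 →
      HasSum (fun n : ℕ => jacksonTerm q m a b y (q / (m * y) * q ^ n)) (q / (m * y) * N y) :=
    fun y hy hy0 => by
    rw [hN]
    refine ((hasSum_phi43Normalized hq (h y hy)).mul_left (q / (m * y))).congr_fun fun n => ?_
    have e1 : m * y * (q / (m * y) * q ^ n) = q * q ^ n := by field_simp
    have e2 : y * (q / (m * y) * q ^ n) = q / m * q ^ n := by field_simp
    have e3 : ∀ j, m * b j * (q / (m * y) * q ^ n) = q * b j / y * q ^ n := fun j => by field_simp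
    have e4 : ∀ j, a j * (q / (m * y) * q ^ n) = a j * q / (m * y) * q ^ n := fun j => by ring
    simp only [jacksonTerm, Fin.prod_univ_three, Fin.prod_univ_four, Matrix.cons_val, e1, e2, e3, e4]
    ring
  have h₁ := hsum (x / q) (by simp) (by positivity)
  have h₃ := hsum x (by simp) hx0
  have h₂ := hsum (q * x) (by simp) (by positivity)
  rw [show q / (m * (x / q)) = q ^ 2 / (m * x) by field_simp] at h₁
  -- The sums for `x / q`, `x`, `q x` start at `q²/(mx)`, `q/(mx)`, `1/(mx)`. Removing none, one and
  -- two terms aligns them at `q²/(mx)`.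
  rw [← hasSum_nat_add_iff' 1] at h₃
  rw [← hasSum_nat_add_iff' 2] at h₂
  simp only [Finset.sum_range_succ, Finset.sum_range_zero, zero_add, pow_zero, pow_one, mul_one,
    show q / (m * (q * x)) = 1 / (m * x) by field_simp] at h₂ h₃
  rw [show 1 / (m * x) * q = q / (m * x) by ring] at h₂
  simp only [show ∀ n : ℕ, 1 / (m * x) * q ^ (n + 2) = q ^ 2 / (m * x) * q ^ n from
    fun n => by ring] at h₂
  simp only [show ∀ n : ℕ, q / (m * x) * q ^ (n + 1) = q ^ 2 / (m * x) * q ^ n from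
    fun n => by ring] at h₃
  have hb : ∀ j, ∀ n : ℕ, qPochInf q (b j / x * q ^ n) ≠ 0 := fun j n => by
    have := fun k => qPochInf_mul_pow_ne_zero hq ((h (q * x) (by simp)).1 k) n
    rw [show b j / x = q * b j / (q * x) by field_simp]
    fin_cases j
    · exact this 0
    · exact this 1
    · exact this 2
  have hqm : ∀ n : ℕ, qPochInf q (q / m * q ^ n) ≠ 0 :=
    qPochInf_mul_pow_ne_zero hq ((h x (by simp)).1 3)
  have key := jackson_sum_equation (s := q ^ 2 / (m * x)) hq hq0 hm hab (x := x)
    (fun n => by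
      rw [show x * (q ^ 2 / (m * x) * q ^ n / q) = q / m * q ^ n by field_simp]
      exact hqm n)
    (fun j n => by
      rw [show m * b j * (q ^ 2 / (m * x) * q ^ n) = b j / x * q ^ (n + 2) by field_simp; ring]
      exact hb j _)
    h₁ h₂ h₃
  have bd := jackson_boundary (x := x) hq hq0 hm hx0 hab (by simpa using hqm 0)
    (fun j => by simpa using hb j 0)
  linear_combination (norm := skip) m / q * (key + bd)
  field_simp
  ring

/-! ### Complex powers and the equation in the variables `a`, `b`, `m`. -/

theorem cpw_add (w a b : ℂ) : cpw w (a + b) = cpw w a * cpw w b := by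
  rw [cpw, add_mul, Complex.exp_add, cpw, cpw]

theorem cpw_neg (w a : ℂ) : cpw w (-a) = (cpw w a)⁻¹ := by
  rw [cpw, neg_mul, Complex.exp_neg, cpw]

theorem cpw_sub (w a b : ℂ) : cpw w (a - b) = cpw w a / cpw w b := by
  rw [sub_eq_add_neg, cpw_add, cpw_neg, div_eq_mul_inv]

theorem cpw_ne_zero (w a : ℂ) : cpw w a ≠ 0 := Complex.exp_ne_zero _

theorem cpw_add_left (w v a : ℂ) : cpw (w + v) a = cpw w a * cpw v a := by
  rw [cpw, mul_add, Complex.exp_add, cpw, cpw]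

theorem cpw_sub_left (w v a : ℂ) : cpw (w - v) a = cpw w a / cpw v a := by
  rw [cpw, mul_sub, Complex.exp_sub, cpw, cpw]

theorem cpw_one {q L : ℂ} (hL : Complex.exp L = q) : cpw L 1 = q := by
  rw [cpw, one_mul, hL]

theorem cpw_parameter_relation {q L lam : ℂ} {h l t : Fin 3 → ℂ} (hL : Complex.exp L = q)
    (hlam : lam = (h 0 + h 1 + h 2 - l 0 - l 1 - l 2 + 1) / 2) :
    cpw L lam ^ 2 * q ^ 2 * ((cpw L (l 0 - 1 / 2) * t 0) * (cpw L (l 1 - 1 / 2) * t 1) *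
        (cpw L (l 2 - 1 / 2) * t 2)) =
      (cpw L (h 0 + 1 / 2) * t 0) * (cpw L (h 1 + 1 / 2) * t 1) * (cpw L (h 2 + 1 / 2) * t 2) := by
  have : cpw L lam ^ 2 * q ^ 2 * (cpw L (l 0 - 1 / 2) * cpw L (l 1 - 1 / 2) * cpw L (l 2 - 1 / 2))
      = cpw L (h 0 + 1 / 2) * cpw L (h 1 + 1 / 2) * cpw L (h 2 + 1 / 2) := by
    rw [← cpw_one hL, sq, sq]
    simp only [← cpw_add]
    congr 1
    rw [hlam]
    ring
  linear_combination t 0 * t 1 * t 2 * this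

theorem variantDegThree_eq {q L lam α : ℂ} {h l t : Fin 3 → ℂ} (hL : Complex.exp L = q)
    (hlam : lam = (h 0 + h 1 + h 2 - l 0 - l 1 - l 2 + 1) / 2) {a b : Fin 3 → ℂ}
    (ha : ∀ j, a j = cpw L (h j + 1 / 2) * t j) (hb : ∀ j, b j = cpw L (l j - 1 / 2) * t j)
    (g : ℂ → ℂ) (u : ℂ) :
    variantDegThree q L α h l t g u =
      (Complex.exp u - a 0) * (Complex.exp u - a 1) * (Complex.exp u - a 2) * g (u - L)
      + cpw L (2 * α + 1) * ((Complex.exp u - b 0) * (Complex.exp u - b 1) * (Complex.exp u - b 2))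
        * g (u + L)
      + cpw L α * middleCoeff q (cpw L lam) (Complex.exp u) a b * g u := by
  have h2 : ∀ j, cpw L (1 / 2) * (cpw L (h j) + cpw L (l j)) * t j = a j + q * b j := fun j => by
    rw [ha, hb, ← cpw_one hL, mul_add, ← mul_assoc (cpw L 1), ← cpw_add, ← cpw_add, ← cpw_add]
    ring_nf
  -- The exponent `(Σh + Σl + 1)/2` equals both `λ + Σl` and `Σh + 1 - λ`; the first form serves the
  -- `l` terms, the second the `h` terms.
  have h1 : ∀ i j k, h i + h j + h k = h 0 + h 1 + h 2 → l i + l j + l k = l 0 + l 1 + l 2 →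
      cpw L ((h 0 + h 1 + h 2 + l 0 + l 1 + l 2 + 1) / 2) * (cpw L (-h i) + cpw L (-l i))
        * t j * t k = cpw L lam * q * (b j * b k) + a j * a k / cpw L lam := fun i j k eh el => by
    have f1 : cpw L ((h 0 + h 1 + h 2 + l 0 + l 1 + l 2 + 1) / 2) * cpw L (-h i) =
        cpw L (h j + 1 / 2) * cpw L (h k + 1 / 2) / cpw L lam := by
      rw [← cpw_add, ← cpw_add, ← cpw_sub, hlam]
      congr 1
      linear_combination -eh
    have f2 : cpw L ((h 0 + h 1 + h 2 + l 0 + l 1 + l 2 + 1) / 2) * cpw L (-l i) =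
        cpw L lam * q * (cpw L (l j - 1 / 2) * cpw L (l k - 1 / 2)) := by
      rw [← cpw_one hL]
      simp only [← cpw_add]
      congr 1
      rw [hlam]
      linear_combination -el
    rw [ha, ha, hb, hb]
    linear_combination t j * t k * (f1 + f2)
  have h0 : cpw L ((h 0 + h 1 + h 2 + l 0 + l 1 + l 2) / 2) * t 0 * t 1 * t 2 =
      cpw L lam * q * (b 0 * b 1 * b 2) := by
    have f : cpw L ((h 0 + h 1 + h 2 + l 0 + l 1 + l 2) / 2) =
        cpw L lam * q * (cpw L (l 0 - 1 / 2) * cpw L (l 1 - 1 / 2) * cpw L (l 2 - 1 / 2)) := by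
      rw [← cpw_one hL]
      simp only [← cpw_add]
      congr 1
      rw [hlam]
      ring
    rw [hb, hb, hb]
    linear_combination t 0 * t 1 * t 2 * f
  simp only [variantDegThree, middleCoeff, ← ha, ← hb]
  linear_combination cpw L α * g u * (Complex.exp u ^ 2 * (h2 0 + h2 1 + h2 2)
    - Complex.exp u * (h1 0 1 2 rfl rfl + h1 1 0 2 (by ring) (by ring)
      + h1 2 0 1 (by ring) (by ring)) + (q + 1) * h0)

/-- The shifts of `x^{λ-α}` produce `q^{∓(λ-α)}`, so every term carries the nonzero factor `q^α
x^{λ-α}`, and `α` disappears. -/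
theorem solvesNonHomAt_iff {q L lam α : ℂ} {h l t : Fin 3 → ℂ} (hL : Complex.exp L = q)
    (hlam : lam = (h 0 + h 1 + h 2 - l 0 - l 1 - l 2 + 1) / 2) {a b : Fin 3 → ℂ}
    (ha : ∀ j, a j = cpw L (h j + 1 / 2) * t j) (hb : ∀ j, b j = cpw L (l j - 1 / 2) * t j)
    {g S : ℂ → ℂ} (hg : ∀ v, g v = cpw v (lam - α) * S (Complex.exp v)) (u : ℂ) :
    SolvesNonHomAt q L lam α h l t g u ↔
      (cpw L lam)⁻¹ * ((Complex.exp u - a 0) * (Complex.exp u - a 1) * (Complex.exp u - a 2)) *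
        S (Complex.exp u / q)
      + cpw L lam * q * ((Complex.exp u - b 0) * (Complex.exp u - b 1) * (Complex.exp u - b 2)) *
        S (q * Complex.exp u)
      + middleCoeff q (cpw L lam) (Complex.exp u) a b * S (Complex.exp u)
      + (1 - cpw L lam) * Complex.exp u ^ 2 = 0 := by
  have e1 : Complex.exp (u - L) = Complex.exp u / q := by rw [Complex.exp_sub, hL]
  have e2 : Complex.exp (u + L) = q * Complex.exp u := by rw [Complex.exp_add, hL, mul_comm]
  have e3 : cpw L (2 * α + 1) = cpw L α ^ 2 * q := by
    rw [cpw_add, cpw_one hL, two_mul, cpw_add, sq]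
  have e4 : cpw u (lam - α + 2) = cpw u (lam - α) * Complex.exp u ^ 2 := by
    rw [cpw_add]
    congr 1
    rw [cpw, ← Complex.exp_nat_mul]
    push_cast
    rfl
  rw [SolvesNonHomAt, variantDegThree_eq hL hlam ha hb, hg, hg, hg, e1, e2, e3, e4, cpw_sub_left,
    cpw_add_left, cpw_sub L]
  have n1 := cpw_ne_zero L α
  have n2 := cpw_ne_zero u (lam - α)
  have n3 := cpw_ne_zero L lam
  refine Iff.trans (Eq.congr ?_ rfl) (mul_eq_zero.trans (or_iff_right (mul_ne_zero n1 n2)))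
  generalize cpw u (lam - α) = c at *
  field_simp

/-! ### Matching the series parameters, and the two families of solutions. -/

theorem upperG_eq {L lam : ℂ} {h l t : Fin 3 → ℂ} (ht : ∀ k, t k ≠ 0) (i i' i'' : Fin 3)
    (u : ℂ) : upperG L lam h l t i i' i'' u =
      ![Complex.exp u * (cpw L (-h i + 1 / 2) / t i),
        cpw L lam * (cpw L (l i - 1 / 2) * t i) * (cpw L (-h i + 1 / 2) / t i),
        cpw L lam * (cpw L (l i' - 1 / 2) * t i') * (cpw L (-h i + 1 / 2) / t i),
        cpw L lam * (cpw L (l i'' - 1 / 2) * t i'') * (cpw L (-h i + 1 / 2) / t i)] := by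
  have e : ∀ j, cpw L (lam + l j - h i) =
      cpw L lam * cpw L (l j - 1 / 2) * cpw L (-h i + 1 / 2) := fun j => by
    rw [← cpw_add, ← cpw_add]
    ring_nf
  have := ht i
  rw [upperG, e, e, e]
  congr 1
  · ring
  congr 1
  · field_simp
  congr 1
  · ring
  congr 1
  ring

theorem lowerG_eq {L lam : ℂ} (h t : Fin 3 → ℂ) (i i' i'' : Fin 3) (u : ℂ) :
    lowerG L lam h t i i' i'' u =
      ![cpw L lam * Complex.exp u * (cpw L (-h i + 1 / 2) / t i),
        cpw L (h i' + 1 / 2) * t i' * (cpw L (-h i + 1 / 2) / t i),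
        cpw L (h i'' + 1 / 2) * t i'' * (cpw L (-h i + 1 / 2) / t i)] := by
  have e : ∀ j, cpw L (h j - h i + 1) = cpw L (h j + 1 / 2) * cpw L (-h i + 1 / 2) := fun j => by
    rw [← cpw_add]
    ring_nf
  have e' : cpw L (lam - h i + 1 / 2) = cpw L lam * cpw L (-h i + 1 / 2) := by
    rw [← cpw_add]
    ring_nf
  rw [lowerG, e, e, e']
  congr 1
  · ring
  congr 1
  · ring
  congr 1
  ring

theorem upperZero_eq {q L lam : ℂ} (hL : Complex.exp L = q) (l t : Fin 3 → ℂ) (u : ℂ) :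
    upperZero L lam l t u =
      ![q * (cpw L (l 0 - 1 / 2) * t 0) / Complex.exp u,
        q * (cpw L (l 1 - 1 / 2) * t 1) / Complex.exp u,
        q * (cpw L (l 2 - 1 / 2) * t 2) / Complex.exp u, q / cpw L lam] := by
  have e : ∀ j, cpw L (l j + 1 / 2) = q * cpw L (l j - 1 / 2) := fun j => by
    rw [← cpw_one hL, ← cpw_add]
    ring_nf
  rw [upperZero, e, e, e, cpw_sub L 1, cpw_one hL]
  simp only [mul_assoc]

theorem lowerZero_eq {q L lam : ℂ} (hL : Complex.exp L = q) (h t : Fin 3 → ℂ) (u : ℂ) :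
    lowerZero L lam h t u =
      ![cpw L (h 0 + 1 / 2) * t 0 * q / (cpw L lam * Complex.exp u),
        cpw L (h 1 + 1 / 2) * t 1 * q / (cpw L lam * Complex.exp u),
        cpw L (h 2 + 1 / 2) * t 2 * q / (cpw L lam * Complex.exp u)] := by
  have e : ∀ j, cpw L (-lam + h j + 3 / 2) = cpw L (h j + 1 / 2) * q / cpw L lam := fun j => by
    rw [← cpw_one hL, ← cpw_add, ← cpw_sub]
    ring_nf
  rw [lowerZero, e, e, e]
  congr 1
  · ring
  congr 1
  · ring
  congr 1
  ring

theorem symmetric_functions_perm (f : Fin 3 → ℂ) {i i' i'' : Fin 3}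
    (h₁ : i ≠ i') (h₂ : i ≠ i'') (h₃ : i' ≠ i'') :
    f i + f i' + f i'' = f 0 + f 1 + f 2 ∧ f i * f i' * f i'' = f 0 * f 1 * f 2 ∧
      f i' * f i'' + f i * f i'' + f i * f i' = f 1 * f 2 + f 0 * f 2 + f 0 * f 1 := by
  fin_cases i <;> fin_cases i' <;> fin_cases i'' <;>
    first
    | exact absurd rfl h₁
    | exact absurd rfl h₂
    | exact absurd rfl h₃
    | (simp only [Fin.zero_eta, Fin.mk_one, Fin.reduceFinMk]
       refine ⟨?_, ?_, ?_⟩ <;> first | trivial | ring1)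

theorem gI_solves {q L lam : ℂ} {h l t : Fin 3 → ℂ} (hq : ‖q‖ < 1)
    (hL : Complex.exp L = q) (ht : ∀ k, t k ≠ 0)
    (hlam : lam = (h 0 + h 1 + h 2 - l 0 - l 1 - l 2 + 1) / 2) (α : ℂ) {i i' i'' : Fin 3}
    (h₁ : i ≠ i') (h₂ : i ≠ i'') (h₃ : i' ≠ i'') (u : ℂ)
    (hz : ∀ v ∈ ({u - L, u, u + L} : Set ℂ),
      NoZeroDenominators q (upperG L lam h l t i i' i'' v) (lowerG L lam h t i i' i'' v)) :
    SolvesNonHomAt q L lam α h l t (gI q L lam α h l t i i' i'') u := by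
  have hq0 : q ≠ 0 := hL ▸ Complex.exp_ne_zero L
  set a : Fin 3 → ℂ := fun j => cpw L (h j + 1 / 2) * t j with ha
  set b : Fin 3 → ℂ := fun j => cpw L (l j - 1 / 2) * t j with hb
  set s : ℂ := cpw L (-h i + 1 / 2) / t i with hs
  set m : ℂ := cpw L lam with hm
  let N : ℂ → ℂ := fun y => phi43Normalized q ![y * s, m * b i * s, m * b i' * s, m * b i'' * s]
      ![m * y * s, a i' * s, a i'' * s]
  -- The sum is `s * N`, and the factor `m / q` turns the limit `-(q(1-m)/m) x²` into `-(1-m) x²`.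
  have hK : cpw L (lam - h i - 1 / 2) / t i = m * s / q := by
    rw [hm, hs, ← cpw_one hL, ← mul_div_assoc, ← cpw_add, div_right_comm, ← cpw_sub]
    ring_nf
  have hrel : m ^ 2 * q ^ 2 * (b 0 * b 1 * b 2) = a 0 * a 1 * a 2 := cpw_parameter_relation hL hlam
  rw [solvesNonHomAt_iff hL hlam (a := a) (b := b) (S := fun y => m * s / q * N y)
    (fun _ => rfl) (fun _ => rfl)
    (fun v => by rw [gI, hK, upperG_eq ht, lowerG_eq, mul_assoc])]
  have hsi : a i * s = q := by
    have := ht i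
    have e : q = cpw L (h i + 1 / 2) * cpw L (-h i + 1 / 2) := by
      rw [← cpw_one hL, ← cpw_add]
      ring_nf
    change cpw L (h i + 1 / 2) * t i * s = q
    rw [hs, ← mul_div_assoc, mul_right_comm, mul_div_cancel_right₀ _ this, e]
  have hz' : ∀ y ∈ ({Complex.exp u / q, Complex.exp u, q * Complex.exp u} : Set ℂ),
      NoZeroDenominators q ![y * s, m * b i * s, m * b i' * s, m * b i'' * s]
        ![m * y * s, a i' * s, a i'' * s] := by
    intro y hy
    obtain ⟨v, hv, rfl⟩ : ∃ v ∈ ({u - L, u, u + L} : Set ℂ), Complex.exp v = y := by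
      rcases hy with rfl | rfl | rfl
      · exact ⟨u - L, by simp, by rw [Complex.exp_sub, hL]⟩
      · exact ⟨u, by simp, rfl⟩
      · exact ⟨u + L, by simp, by rw [Complex.exp_add, hL, mul_comm]⟩
    have := hz v hv
    rwa [upperG_eq ht, lowerG_eq] at this
  -- The equation is symmetric in the `a j` and in the `b j`, so the index `i` may be moved to the
  -- first place.
  have hsymm := fun f => symmetric_functions_perm f h₁ h₂ h₃
  have key := equation_of_fixed_endpoint (x := Complex.exp u) (a := ![a i, a i', a i''])
    (b := ![b i, b i', b i'']) (N := N) hq hq0 (cpw_ne_zero L lam)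
    (by simpa [(hsymm a).2.1, (hsymm b).2.1] using hrel) hsi (fun _ => rfl) hz'
  simp only [middleCoeff, Matrix.cons_val, hsymm a, hsymm b] at key
  have pa := (hsymm fun j => Complex.exp u - a j).2.1
  have pb := (hsymm fun j => Complex.exp u - b j).2.1
  rw [pa, pb] at key
  exact key

theorem gZero_solves {q L lam : ℂ} {h l t : Fin 3 → ℂ} (hq : ‖q‖ < 1)
    (hL : Complex.exp L = q)
    (hlam : lam = (h 0 + h 1 + h 2 - l 0 - l 1 - l 2 + 1) / 2) (α : ℂ) (u : ℂ)
    (hz : ∀ v ∈ ({u - L, u, u + L} : Set ℂ),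
      NoZeroDenominators q (upperZero L lam l t v) (lowerZero L lam h t v)) :
    SolvesNonHomAt q L lam α h l t (gZero q L lam α h l t) u := by
  have hq0 : q ≠ 0 := hL ▸ Complex.exp_ne_zero L
  obtain ⟨a, ha⟩ : ∃ a : Fin 3 → ℂ, ∀ j, a j = cpw L (h j + 1 / 2) * t j := ⟨_, fun _ => rfl⟩
  obtain ⟨b, hb⟩ : ∃ b : Fin 3 → ℂ, ∀ j, b j = cpw L (l j - 1 / 2) * t j := ⟨_, fun _ => rfl⟩
  obtain ⟨N, hN⟩ : ∃ N : ℂ → ℂ, ∀ y, N y = phi43Normalized q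
      ![q * b 0 / y, q * b 1 / y, q * b 2 / y, q / cpw L lam]
      ![a 0 * q / (cpw L lam * y), a 1 * q / (cpw L lam * y), a 2 * q / (cpw L lam * y)] :=
    ⟨_, fun _ => rfl⟩
  -- The division by `y` is the extra `-1` in the exponent `λ - α - 1`; it agrees with `(m / q) * s`
  -- at `s = q / (m y)`.
  rw [solvesNonHomAt_iff hL hlam ha hb (S := fun y => N y / y) (fun v => by
      simp only [gZero, upperZero_eq hL, lowerZero_eq hL, cpw_sub v (lam - α), cpw_one rfl, hN,
        ← ha, ← hb]
      ring)]
  have hrel := cpw_parameter_relation (t := t) hL hlam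
  simp only [← ha, ← hb] at hrel
  refine equation_of_moving_endpoint hq hq0 (cpw_ne_zero L lam) (Complex.exp_ne_zero u)
    hrel hN ?_
  intro y hy
  obtain ⟨v, hv, rfl⟩ : ∃ v ∈ ({u - L, u, u + L} : Set ℂ), Complex.exp v = y := by
    rcases hy with rfl | rfl | rfl
    · exact ⟨u - L, by simp, by rw [Complex.exp_sub, hL]⟩
    · exact ⟨u, by simp, rfl⟩
    · exact ⟨u + L, by simp, by rw [Complex.exp_add, hL, mul_comm]⟩
  have := hz v hv
  simpa only [upperZero_eq hL, lowerZero_eq hL, ← ha, ← hb] using this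

end QHyp

end

theorem theorem4p10 (q L : ℂ) (hq0 : 0 < ‖q‖) (hq1 : ‖q‖ < 1) (hL : Complex.exp L = q)
    (h l t : Fin 3 → ℂ) (α lam : ℂ) (ht : ∀ k, t k ≠ 0)
    (hlam : lam = (h 0 + h 1 + h 2 - l 0 - l 1 - l 2 + 1) / 2) :
    (∀ i i' i'' : Fin 3, i ≠ i' → i ≠ i'' → i' ≠ i'' →
      (∀ u : ℂ, QHyp.NoZeroDenominators q (QHyp.upperG L lam h l t i i' i'' u)
            (QHyp.lowerG L lam h t i i' i'' u) →
          Summable (QHyp.phi43Term q (QHyp.upperG L lam h l t i i' i'' u)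
            (QHyp.lowerG L lam h t i i' i'' u) q)) ∧
      (∀ u : ℂ,
        (∀ v ∈ ({u - L, u, u + L} : Set ℂ),
          QHyp.NoZeroDenominators q (QHyp.upperG L lam h l t i i' i'' v)
            (QHyp.lowerG L lam h t i i' i'' v)) →
        QHyp.SolvesNonHomAt q L lam α h l t (QHyp.gI q L lam α h l t i i' i'') u)) ∧
    (∀ u : ℂ, QHyp.NoZeroDenominators q (QHyp.upperZero L lam l t u)
          (QHyp.lowerZero L lam h t u) →
        Summable (QHyp.phi43Term q (QHyp.upperZero L lam l t u)
          (QHyp.lowerZero L lam h t u) q)) ∧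
    (∀ u : ℂ,
      (∀ v ∈ ({u - L, u, u + L} : Set ℂ),
        QHyp.NoZeroDenominators q (QHyp.upperZero L lam l t v)
          (QHyp.lowerZero L lam h t v)) →
      QHyp.SolvesNonHomAt q L lam α h l t (QHyp.gZero q L lam α h l t) u) := by

  refine ⟨fun i i' i'' h₁ h₂ h₃ => ⟨fun u hu => QHyp.summable_phi43Term hq1 hu,
    fun u hu => QHyp.gI_solves hq1 hL ht hlam α h₁ h₂ h₃ u hu⟩,
    fun u hu => QHyp.summable_phi43Term hq1 hu,
    fun u hu => QHyp.gZero_solves hq1 hL hlam α u hu⟩
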